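/- **Corollary (Unavoidable limits on total energy-per-bit).** Fix constants $\lambda,\mu,\zeta,\sigma_z^2,W,R>0$. *Implementation model $(\lambda,\mu)$.* A circuit is a square $[0,l]^2$ (of any side $l>0$) together with a finite set of nodes, all of them points of the lattice $\lambda\mathbb{Z}^2$ in that square. In a fixed-message-length computation on a circuit, distinct input bits are stored at distinct nodes, distinct output bits at distinct nodes, and a predetermined sequence of binary messages is sent, each from a predetermined node to another predetermined node and of a predetermined length that does not depend on the input. Each message is a function of the input bit stored at the transmitting node (if any) and of the messages that node has received before; in the end each output bit is a function of the input bit stored at its node (if any) and of all messages received there. The bit-meters of the computation are the sum, over all ordered pairs of distinct nodes, of the total number of bits sent from the first node to the second times the Euclidean distance between them; the energy of the computation is $\mu$ times its bit-meters. *Communication system.* For $k,n\ge 1$ with $k/n=R$, an encoder (a fixed-message-length computation with $k$ input bits and $n$ output bits, on some circuit) maps $k$ fair coin flips $\mathbf b$ to a codeword in $\{0,1\}^n$. The codeword is sent with BPSK at transmit power $P_T\ge 0$ through an AWGN channel with path loss $\zeta$, noise variance $\sigma_z^2$ and $W$ channel uses per second, followed by hard decisions; that is, through $n$ uses of the binary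 symmetric channel with crossover probability $p_{ch}=\mathbb{Q}\big(\sqrt{\zeta P_T/\sigma_z^2}\big)$, where $\mathbb{Q}(x)=\int_x^\infty \frac{1}{\sqrt{2\pi}}e^{-t^2/2}\,dt$. A decoder (a fixed-message-length computation with $n$ input bits and $k$ output bits, on some circuit) maps the $n$ hard decisions to an estimate $\widehat{\mathbf b}$. Let $P_e^{blk}=\Pr(\widehat{\mathbf b}\ne\mathbf b)$, and let $$E_{total}=\frac{nP_T}{W}+\mu\cdot\text{bit-meters}(\text{encoder})+\mu\cdot\text{bit-meters}(\text{decoder}).$$ *Claim.* There are $c,\varepsilon>0$, depending only on $\lambda,\mu,\zeta,\sigma_z^2,W,R$, such that every such communication system (with any $k$, $n$, $P_T$, circuits, encoder and decoder) with $P_e^{blk}\le\varepsilon$ satisfies $$\frac{E_{total}}{k}\ \ge\ c\,\sqrt[3]{\log\frac{1}{P_e^{blk}}}.$$ Consequently the total energy per bit diverges as $P_e^{blk}\to 0$: for every $M$ there is $\varepsilon>0$ such that every such system with $P_e^{blk}\le\varepsilon$ has $E_{total}/k\ge M$. -/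

import Mathlib

/-! ### Substrate, grid and circuits -/

/-- The plane, with its Euclidean distance. -/
abbrev Plane : Type := EuclideanSpace ℝ (Fin 2)

/-- The substrate `Sq(l)`: the square with vertices `(0,0)`, `(0,l)`, `(l,0)`, `(l,l)`. -/
def Substrate (l : ℝ) : Set Plane :=
  {p | ∀ i, 0 ≤ p i ∧ p i ≤ l}

/-- The points `(s * lam, t * lam)` with `s`, `t` integers. -/
def SquareLattice (lam : ℝ) : Set Plane :=
  {p | ∃ s t : ℤ, p 0 = s * lam ∧ p 1 = t * lam}

/-- The lattice points that lie in the substrate. -/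
def Grid (lam l : ℝ) : Set Plane :=
  SquareLattice lam ∩ Substrate l

/-- A circuit: a substrate together with a (necessarily finite) set of grid points, the
computational nodes. -/
structure Circuit (lam : ℝ) where
  side : ℝ
  side_pos : 0 < side
  nodes : Finset Plane
  nodes_subset : (nodes : Set Plane) ⊆ Grid lam side

/-- The computational nodes of a circuit, as a (finite) type. -/
abbrev Circuit.Node {lam : ℝ} (C : Circuit lam) : Type := {p : Plane // p ∈ C.nodes}

/-! ### Fixed-message-length computation -/

/-- A fixed-message-length computation on the circuit `C`, with `m` input bits and `m'` output bits.
Distinct input bits are stored at distinct nodes, and so are distinct output bits.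
A predetermined sequence of messages is sent: the `t`-th one goes from the node `src t` to another
node `dst t` and has the predetermined length `bits t`. Its content is computed by the
function `rule t` from what the transmitting node knows at that time: its input bit, if it is an
input node, and the messages which it has received before. In the end each output bit is computed
in the same manner from what its output node knows. -/
structure FixedLengthComputation {lam : ℝ} (C : Circuit lam) (m m' : ℕ) where
  inputNode : Fin m ↪ C.Node
  outputNode : Fin m' ↪ C.Node
  numMessages : ℕ
  src : Fin numMessages → C.Node
  dst : Fin numMessages → C.Node
  src_ne_dst : ∀ t, src t ≠ dst t
  bits : Fin numMessages → ℕ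
  rule : (t : Fin numMessages) →
    ({i : Fin m // inputNode i = src t} → Bool) →
    ((s : {s : Fin numMessages // s < t ∧ dst s = src t}) → Fin (bits s.1) → Bool) →
    Fin (bits t) → Bool
  outputRule : (j : Fin m') →
    ({i : Fin m // inputNode i = outputNode j} → Bool) →
    ((s : {s : Fin numMessages // dst s = outputNode j}) → Fin (bits s.1) → Bool) →
    Bool

namespace FixedLengthComputation

variable {lam : ℝ} {C : Circuit lam} {m m' : ℕ}

/-- The content of the `t`-th message when the computation is run on the input `x`. -/
def message (A : FixedLengthComputation C m m') (x : Fin m → Bool) (t : Fin A.numMessages) :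
    Fin (A.bits t) → Bool :=
  A.rule t (fun i => x i.1) (fun s => A.message x s.1)
termination_by t.1
decreasing_by exact s.2.1

/-- The output of the computation on the input `x`. -/
def output (A : FixedLengthComputation C m m') (x : Fin m → Bool) : Fin m' → Bool :=
  fun j => A.outputRule j (fun i => x i.1) (fun s => A.message x s.1)

open Classical in
/-- The total number of bits carried by the messages on the link from `u` to `v`. -/
noncomputable def linkBits (A : FixedLengthComputation C m m') (u v : C.Node) : ℕ :=
  ∑ t : Fin A.numMessages, if A.src t = u ∧ A.dst t = v then A.bits t else 0

/-- The bit-meters of the link from `u` to `v`. -/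
noncomputable def linkBitMeters (A : FixedLengthComputation C m m') (u v : C.Node) : ℝ :=
  (A.linkBits u v : ℝ) * dist (u : Plane) (v : Plane)

/-- The bit-meters of the computation: the sum over all (unidirectional) links. -/
noncomputable def bitMeters (A : FixedLengthComputation C m m') : ℝ :=
  ∑ u : C.Node, ∑ v : C.Node, A.linkBitMeters u v

/-- The information-friction energy, with coefficient of information-friction `mu`. -/
noncomputable def frictionEnergy (A : FixedLengthComputation C m m') (mu : ℝ) : ℝ :=
  mu * A.bitMeters

end FixedLengthComputation

/-! ### The channel -/

/-- The Gaussian tail function. -/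
noncomputable def gaussianQ (x : ℝ) : ℝ :=
  ∫ t in Set.Ioi x, 1 / Real.sqrt (2 * Real.pi) * Real.exp (-t ^ 2 / 2)

/-- The raw bit-error probability after a hard decision on BPSK symbols of power `P`, for path loss
`zeta` and noise variance `sigmaSq`. -/
noncomputable def crossover (zeta sigmaSq P : ℝ) : ℝ :=
  gaussianQ (Real.sqrt (zeta * P / sigmaSq))

/-- Transition probability of `n` uses of the binary symmetric channel with crossover
probability `p`. -/
noncomputable def bscProb {n : ℕ} (p : ℝ) (x y : Fin n → Bool) : ℝ :=
  ∏ i, if y i = x i then 1 - p else p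

/-! ### The communication system -/

/-- A communication system of rate `R` whose encoder and decoder are fixed-message-length
computations on circuits with node spacing `lam`: `k` information bits, block length `n`,
transmit power `power`. -/
structure CommSystem (lam R : ℝ) where
  k : ℕ
  n : ℕ
  k_pos : 0 < k
  n_pos : 0 < n
  rate_eq : (k : ℝ) / (n : ℝ) = R
  power : ℝ
  power_nonneg : 0 ≤ power
  encCircuit : Circuit lam
  encoder : FixedLengthComputation encCircuit k n
  decCircuit : Circuit lam
  decoder : FixedLengthComputation decCircuit n k

namespace CommSystem

variable {lam R : ℝ}

/-- The average block-error probability: `k` fair coin flips `b` are encoded, sent through the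
channel, and decoded from the channel output `y`. -/
noncomputable def blockErrorProb (S : CommSystem lam R) (zeta sigmaSq : ℝ) : ℝ :=
  ∑ b : Fin S.k → Bool, (1 / 2 : ℝ) ^ S.k *
    ∑ y : Fin S.n → Bool,
      bscProb (crossover zeta sigmaSq S.power) (S.encoder.output b) y *
        (if S.decoder.output y = b then 0 else 1)

/-- The transmit energy of a block: `n` channel uses, at `W` channel uses per second. -/
noncomputable def transmitEnergy (S : CommSystem lam R) (W : ℝ) : ℝ :=
  S.n * S.power / W

/-- Total energy of a block: transmission, encoding, and decoding. -/
noncomputable def totalEnergy (S : CommSystem lam R) (mu W : ℝ) : ℝ :=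
  S.transmitEnergy W + S.encoder.frictionEnergy mu + S.decoder.frictionEnergy mu

/-- Total energy per information bit. -/
noncomputable def energyPerBit (S : CommSystem lam R) (mu W : ℝ) : ℝ :=
  S.totalEnergy mu W / S.k

end CommSystem

/-!
The decoder must gather information over distance, and the less it does so, the more it is exposed
to local noise. Divide the lattice into cells of `s × s` points. A bit travelling a distance `d` is
cut by the cell boundaries for at most `O(d)` of the `s` diagonal shifts of this division; hence if
the decoder spends fewer than `δ * s * k` bit-meters, with a small constant `δ`, then for some
shift fewer than `k` bits cross between cells, and some cell receives fewer bits than it has to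
output. Whenever the channel overwrites the at most `s ^ 2` inputs of this cell by zeros, which
happens with probability at least `p_ch ^ (s ^ 2)`, the cell can produce at most half of its
possible outputs, and so half of the messages are decoded wrongly. Thus
`log (1 / P_e) = O(s ^ 2 * log (1 / p_ch))`. With energy `E` per bit, one may take `s = O(1 + E)`,
and `log (1 / p_ch) = O(1 + P_T) = O(1 + E)` by the Gaussian tail, so that
`log (1 / P_e) = O((1 + E) ^ 3)`.
-/

/-! ### The binary symmetric channel -/

theorem bscProb_nonneg {n : ℕ} {p : ℝ} (hp₀ : 0 ≤ p) (hp₁ : p ≤ 1) (x y : Fin n → Bool) :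
    0 ≤ bscProb p x y :=
  Finset.prod_nonneg fun i _ => by split_ifs <;> linarith

theorem pow_card_le_sum_bscProb {n : ℕ} {p : ℝ} (hp₀ : 0 ≤ p) (hp : p ≤ 1 / 2)
    (I : Finset (Fin n)) (w x : Fin n → Bool) :
    p ^ I.card ≤ ∑ y with ∀ i ∈ I, y i = w i, bscProb p x y := by
  have cylinder_eq : (Finset.univ.filter fun y : Fin n → Bool => ∀ i ∈ I, y i = w i) =
      Fintype.piFinset fun i => if i ∈ I then {w i} else Finset.univ := by
    ext y
    simp only [Finset.mem_filter_univ, Fintype.mem_piFinset]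
    refine forall_congr' fun i => ?_
    by_cases hi : i ∈ I <;> simp [hi]
  rw [cylinder_eq]
  unfold bscProb
  rw [← Finset.prod_univ_sum _ fun i b => if b = x i then 1 - p else p]
  calc p ^ I.card = ∏ i, if i ∈ I then p else 1 := by simp
    _ ≤ _ := Finset.prod_le_prod (fun i _ => by split_ifs <;> linarith) fun i _ => by
      by_cases hi : i ∈ I
      · simp only [hi, if_true, Finset.sum_singleton]
        split_ifs <;> linarith
      · cases hx : x i <;> simp [hi]

/-- The average block-error probability of the code with encoding map `enc` and decoding map `dec`
on the binary symmetric channel with crossover probability `p`, for uniformly distributed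
messages. -/
noncomputable def bscErrorProb {k n : ℕ} (p : ℝ) (enc : (Fin k → Bool) → Fin n → Bool)
    (dec : (Fin n → Bool) → Fin k → Bool) : ℝ :=
  ∑ b : Fin k → Bool, (1 / 2 : ℝ) ^ k *
    ∑ y : Fin n → Bool, bscProb p (enc b) y * (if dec y = b then 0 else 1)

theorem pow_card_le_sum_bscProb_error {k n : ℕ} {p : ℝ} (hp₀ : 0 ≤ p) (hp : p ≤ 1 / 2)
    (dec : (Fin n → Bool) → Fin k → Bool) (I : Finset (Fin n)) (w x : Fin n → Bool)
    {b : Fin k → Bool} (hb : ∀ y, (∀ i ∈ I, y i = w i) → dec y ≠ b) :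
    p ^ I.card ≤ ∑ y, bscProb p x y * (if dec y = b then 0 else 1) :=
  calc p ^ I.card ≤ ∑ y with ∀ i ∈ I, y i = w i, bscProb p x y :=
        pow_card_le_sum_bscProb hp₀ hp I w x
    _ = ∑ y with ∀ i ∈ I, y i = w i, bscProb p x y * (if dec y = b then 0 else 1) :=
        Finset.sum_congr rfl fun y hy => by
          rw [if_neg (hb y (Finset.mem_filter_univ y |>.1 hy)), mul_one]
    _ ≤ ∑ y, bscProb p x y * (if dec y = b then 0 else 1) :=
        Finset.sum_le_univ_sum_of_nonneg fun y =>
          mul_nonneg (bscProb_nonneg hp₀ (by linarith) x y) (by split_ifs <;> norm_num)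

theorem pow_card_div_two_le_bscErrorProb {k n : ℕ} {p : ℝ} (hp₀ : 0 ≤ p) (hp : p ≤ 1 / 2)
    (enc : (Fin k → Bool) → Fin n → Bool) (dec : (Fin n → Bool) → Fin k → Bool)
    (I : Finset (Fin n)) (w : Fin n → Bool)
    (hdec : 2 * ((Finset.univ.filter fun y => ∀ i ∈ I, y i = w i).image dec).card ≤ 2 ^ k) :
    p ^ I.card / 2 ≤ bscErrorProb p enc dec := by
  set decodable := (Finset.univ.filter fun y => ∀ i ∈ I, y i = w i).image dec
  have half_le : (1 : ℝ) / 2 ≤ decodableᶜ.card * (1 / 2) ^ k := by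
    have hcard : 2 ^ k ≤ 2 * decodableᶜ.card := by
      have := Finset.card_add_card_compl decodable
      simp only [Fintype.card_pi, Finset.prod_const, Fintype.card_bool, Finset.card_univ,
        Fintype.card_fin] at this
      omega
    have hcard' : (2 : ℝ) ^ k ≤ 2 * decodableᶜ.card := by exact_mod_cast hcard
    rw [one_div_pow, mul_one_div, le_div_iff₀ (by positivity)]
    linarith
  calc p ^ I.card / 2 ≤ decodableᶜ.card * (1 / 2) ^ k * p ^ I.card := by
        linarith [mul_le_mul_of_nonneg_right half_le (pow_nonneg hp₀ I.card)]
    _ = ∑ _b ∈ decodableᶜ, (1 / 2 : ℝ) ^ k * p ^ I.card := by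
        rw [Finset.sum_const, nsmul_eq_mul, mul_assoc]
    _ ≤ ∑ b ∈ decodableᶜ, (1 / 2 : ℝ) ^ k *
          ∑ y, bscProb p (enc b) y * (if dec y = b then 0 else 1) :=
        Finset.sum_le_sum fun b hb => by
          gcongr
          refine pow_card_le_sum_bscProb_error hp₀ hp dec I w _ fun y hy hyb => ?_
          exact Finset.mem_compl.1 hb
            (hyb ▸ Finset.mem_image_of_mem dec (Finset.mem_filter_univ y |>.2 hy))
    _ ≤ bscErrorProb p enc dec := Finset.sum_le_univ_sum_of_nonneg fun b =>
        mul_nonneg (by positivity) (Finset.sum_nonneg fun y _ =>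
          mul_nonneg (bscProb_nonneg hp₀ (by linarith) _ y) (by split_ifs <;> norm_num))

/-! ### Information flow into a region -/

namespace FixedLengthComputation

variable {lam : ℝ} {C : Circuit lam} {m m' : ℕ}

theorem message_eq_of_inflow_eq (A : FixedLengthComputation C m m') {T : Set C.Node}
    {x x' : Fin m → Bool} (hx : ∀ i, A.inputNode i ∈ T → x i = x' i)
    (hin : ∀ t, A.src t ∉ T → A.dst t ∈ T → A.message x t = A.message x' t)
    (t : Fin A.numMessages) (ht : A.src t ∈ T ∨ A.dst t ∈ T) :
    A.message x t = A.message x' t := by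
  induction t using WellFoundedLT.induction with
  | ind t ih =>
    by_cases hsrc : A.src t ∈ T
    · rw [message, message]
      congr 1 <;> funext s
      · exact hx s.1 (by rwa [s.2])
      · exact ih s.1 s.2.1 (.inr (by rwa [s.2.2]))
    · exact hin t hsrc (ht.resolve_left hsrc)

theorem output_eq_of_inflow_eq (A : FixedLengthComputation C m m') {T : Set C.Node}
    {x x' : Fin m → Bool} (hx : ∀ i, A.inputNode i ∈ T → x i = x' i)
    (hin : ∀ t, A.src t ∉ T → A.dst t ∈ T → A.message x t = A.message x' t)
    {j : Fin m'} (hj : A.outputNode j ∈ T) : A.output x j = A.output x' j := by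
  unfold output
  congr 1 <;> funext s
  · exact hx s.1 (by rwa [s.2])
  · exact A.message_eq_of_inflow_eq hx hin s.1 (.inr (by rwa [s.2]))

open scoped Classical in
/-- The input bits stored in the region `T`. -/
noncomputable def inputsIn (A : FixedLengthComputation C m m') (T : Set C.Node) :
    Finset (Fin m) :=
  {i | A.inputNode i ∈ T}

open scoped Classical in
/-- The output bits stored in the region `T`. -/
noncomputable def outputsIn (A : FixedLengthComputation C m m') (T : Set C.Node) :
    Finset (Fin m') :=
  {j | A.outputNode j ∈ T}

open scoped Classical in
/-- The messages that enter the region `T` from outside. -/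
noncomputable def messagesInto (A : FixedLengthComputation C m m') (T : Set C.Node) :
    Finset (Fin A.numMessages) :=
  {t | A.src t ∉ T ∧ A.dst t ∈ T}

/-- The number of bits that enter the region `T` from outside. -/
noncomputable def inflow (A : FixedLengthComputation C m m') (T : Set C.Node) : ℕ :=
  ∑ t ∈ A.messagesInto T, A.bits t

@[simp]
theorem mem_inputsIn {A : FixedLengthComputation C m m'} {T : Set C.Node} {i : Fin m} :
    i ∈ A.inputsIn T ↔ A.inputNode i ∈ T := by
  simp [inputsIn]

@[simp]
theorem mem_outputsIn {A : FixedLengthComputation C m m'} {T : Set C.Node} {j : Fin m'} :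
    j ∈ A.outputsIn T ↔ A.outputNode j ∈ T := by
  simp [outputsIn]

@[simp]
theorem mem_messagesInto {A : FixedLengthComputation C m m'} {T : Set C.Node}
    {t : Fin A.numMessages} : t ∈ A.messagesInto T ↔ A.src t ∉ T ∧ A.dst t ∈ T := by
  simp [messagesInto]

theorem card_image_output_le (A : FixedLengthComputation C m m') (T : Set C.Node)
    (w : Fin m → Bool) :
    ((Finset.univ.filter fun x => ∀ i ∈ A.inputsIn T, x i = w i).image A.output).card ≤
      2 ^ (A.inflow T + (m' - (A.outputsIn T).card)) := by
  set outputs := (Finset.univ.filter fun x => ∀ i ∈ A.inputsIn T, x i = w i).image A.output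
    with outputs_def
  have exists_input : ∀ b ∈ outputs, ∃ x, (∀ i ∈ A.inputsIn T, x i = w i) ∧ A.output x = b := by
    simp [outputs_def]
  choose! x hx hxb using exists_input
  let Transcript := ((t : A.messagesInto T) → Fin (A.bits t) → Bool) ×
    (((A.outputsIn T)ᶜ : Finset (Fin m')) → Bool)
  let transcript (b : Fin m' → Bool) : Transcript := (fun t => A.message (x b) t, fun j => b j)
  have transcript_injOn : Set.InjOn transcript outputs := by
    intro b hb b' hb' h
    obtain ⟨hmessages, houtside⟩ := Prod.ext_iff.1 h
    funext j
    by_cases hj : A.outputNode j ∈ T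
    · rw [← hxb b hb, ← hxb b' hb']
      refine A.output_eq_of_inflow_eq (fun i hi => ?_) (fun t hsrc hdst => ?_) hj
      · rw [hx b hb i (mem_inputsIn.2 hi), hx b' hb' i (mem_inputsIn.2 hi)]
      · exact congrFun hmessages ⟨t, mem_messagesInto.2 ⟨hsrc, hdst⟩⟩
    · exact congrFun houtside ⟨j, by simpa using hj⟩
  have card_transcript :
      Fintype.card Transcript = 2 ^ (A.inflow T + (m' - (A.outputsIn T).card)) := by
    simp only [Transcript, Fintype.card_prod, Fintype.card_pi, Fintype.card_bool,
      Finset.prod_const, Finset.card_univ, Fintype.card_fin, Finset.prod_pow_eq_pow_sum,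
      Finset.univ_eq_attach, Finset.card_attach, Finset.card_compl, pow_add, inflow,
      Finset.sum_attach (A.messagesInto T) A.bits]
  rw [← card_transcript, ← Finset.card_univ]
  exact Finset.card_le_card_of_injOn transcript (fun _ _ => Finset.mem_univ _) transcript_injOn

theorem pow_div_two_le_bscErrorProb_of_inflow_lt {n k : ℕ} (A : FixedLengthComputation C n k)
    {T : Set C.Node} (hT : A.inflow T < (A.outputsIn T).card) {p : ℝ} (hp₀ : 0 ≤ p)
    (hp : p ≤ 1 / 2) (enc : (Fin k → Bool) → Fin n → Bool) :
    p ^ (A.inputsIn T).card / 2 ≤ bscErrorProb p enc A.output := by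
  refine pow_card_div_two_le_bscErrorProb hp₀ hp enc A.output _ (fun _ => false) ?_
  have hle : (A.outputsIn T).card ≤ k := by
    simpa using Finset.card_le_univ (A.outputsIn T)
  calc _ ≤ 2 * 2 ^ (A.inflow T + (k - (A.outputsIn T).card)) :=
        Nat.mul_le_mul_left 2 (A.card_image_output_le T _)
    _ = 2 ^ (A.inflow T + (k - (A.outputsIn T).card) + 1) := (pow_succ' _ _).symm
    _ ≤ 2 ^ k := Nat.pow_le_pow_right two_pos (by omega)

open scoped Classical in
/-- The number of bits that are sent between nodes of different classes of the partition of the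
nodes into the fibres of `f`. -/
noncomputable def crossingBits {β : Type*} (A : FixedLengthComputation C m m') (f : C.Node → β) :
    ℕ :=
  ∑ t with f (A.src t) ≠ f (A.dst t), A.bits t

open scoped Classical in
theorem sum_inflow_fiber {β : Type*} (A : FixedLengthComputation C m m') (f : C.Node → β) :
    ∑ q ∈ Finset.univ.image f, A.inflow (f ⁻¹' {q}) = A.crossingBits f := by
  rw [crossingBits, ← Finset.sum_fiberwise_of_maps_to (g := f ∘ A.dst) (t := Finset.univ.image f)
    fun t _ => Finset.mem_image_of_mem f (Finset.mem_univ _)]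
  refine Finset.sum_congr rfl fun q _ => Finset.sum_congr ?_ fun _ _ => rfl
  ext t
  simp only [mem_messagesInto, Set.mem_preimage, Set.mem_singleton_iff, Finset.mem_filter,
    Finset.mem_univ, true_and, Function.comp_apply]
  exact and_congr_left fun h => by rw [h]

open scoped Classical in
theorem sum_card_outputsIn_fiber {β : Type*} (A : FixedLengthComputation C m m')
    (f : C.Node → β) :
    ∑ q ∈ Finset.univ.image f, (A.outputsIn (f ⁻¹' {q})).card = m' := by
  have h := Finset.card_eq_sum_card_fiberwise (f := f ∘ A.outputNode) (s := Finset.univ)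
    (t := Finset.univ.image f) fun j _ => Finset.mem_image_of_mem f (Finset.mem_univ _)
  rw [Finset.card_univ, Fintype.card_fin] at h
  exact h.symm

theorem exists_inflow_fiber_lt {β : Type*} (A : FixedLengthComputation C m m') {f : C.Node → β}
    (h : A.crossingBits f < m') :
    ∃ q, A.inflow (f ⁻¹' {q}) < (A.outputsIn (f ⁻¹' {q})).card := by
  classical
  obtain ⟨q, -, hq⟩ := Finset.exists_lt_of_sum_lt
    ((A.sum_inflow_fiber f).trans_lt (h.trans_eq (A.sum_card_outputsIn_fiber f).symm))
  exact ⟨q, hq⟩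

end FixedLengthComputation

/-! ### Cells of the lattice -/

theorem sum_range_add_ediv {s : ℕ} (hs : 0 < s) (x : ℤ) :
    ∑ a ∈ Finset.range s, (x + a) / (s : ℤ) = x := by
  have hs' : (s : ℤ) ≠ 0 := by exact_mod_cast hs.ne'
  have step (x : ℤ) : ∑ a ∈ Finset.range s, (x + 1 + a) / (s : ℤ) =
      ∑ a ∈ Finset.range s, (x + a) / (s : ℤ) + 1 := by
    have h := Finset.sum_range_sub (fun a : ℕ => (x + a) / (s : ℤ)) s
    simp only [Finset.sum_sub_distrib, Nat.cast_add, Nat.cast_one, Nat.cast_zero, add_zero,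
      Int.add_ediv_of_dvd_right (dvd_refl (s : ℤ)), Int.ediv_self hs'] at h
    simp only [add_right_comm x 1, ← add_assoc] at h ⊢
    linarith
  induction x using Int.induction_on with
  | zero =>
    refine Finset.sum_eq_zero fun a ha => ?_
    rw [zero_add, Int.ediv_eq_zero_of_lt (by positivity)]
    exact_mod_cast Finset.mem_range.1 ha
  | succ x ih => rw [step, ih]
  | pred x ih =>
    have h := step (-x - 1)
    rw [sub_add_cancel, ih] at h
    linarith

theorem card_filter_add_ediv_ne_le (s : ℕ) (x y : ℤ) :
    (((Finset.range s).filter fun a : ℕ => (x + a) / (s : ℤ) ≠ (y + a) / (s : ℤ)).card : ℤ) ≤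
      |x - y| := by
  wlog hxy : x ≤ y generalizing x y
  · simpa only [ne_comm, abs_sub_comm] using this y x (by omega)
  rcases s.eq_zero_or_pos with rfl | hs
  · simp
  calc _ = ∑ a ∈ Finset.range s, if (x + a) / (s : ℤ) ≠ (y + a) / (s : ℤ) then (1 : ℤ) else 0 := by
        rw [Finset.card_filter, Nat.cast_sum]
        simp only [Nat.cast_ite, Nat.cast_one, Nat.cast_zero]
    _ ≤ ∑ a ∈ Finset.range s, ((y + a) / (s : ℤ) - (x + a) / (s : ℤ)) := by
        refine Finset.sum_le_sum fun a _ => ?_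
        have : (x + a) / (s : ℤ) ≤ (y + a) / (s : ℤ) :=
          Int.ediv_le_ediv (by exact_mod_cast hs) (by linarith)
        split_ifs <;> omega
    _ = |x - y| := by
        rw [Finset.sum_sub_distrib, sum_range_add_ediv hs, sum_range_add_ediv hs, abs_sub_comm,
          abs_of_nonneg (by linarith)]

namespace Circuit

variable {lam : ℝ} {C : Circuit lam}

theorem Node.exists_coord (u : C.Node) :
    ∃ q : ℤ × ℤ, (u : Plane) 0 = q.1 * lam ∧ (u : Plane) 1 = q.2 * lam :=
  let ⟨s, t, h⟩ := (C.nodes_subset u.2).1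
  ⟨(s, t), h⟩

/-- The integer coordinates of a node with respect to the lattice of spacing `lam`. -/
noncomputable def Node.coord (u : C.Node) : ℤ × ℤ := u.exists_coord.choose

theorem Node.apply_zero (u : C.Node) : (u : Plane) 0 = u.coord.1 * lam :=
  u.exists_coord.choose_spec.1

theorem Node.apply_one (u : C.Node) : (u : Plane) 1 = u.coord.2 * lam :=
  u.exists_coord.choose_spec.2

theorem Node.coord_injective : Function.Injective (Node.coord (C := C)) := by
  intro u v h
  ext i
  fin_cases i
  · simp [u.apply_zero, v.apply_zero, h]
  · simp [u.apply_one, v.apply_one, h]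

theorem Node.abs_coord_sub_add_le (hlam : 0 < lam) (u v : C.Node) :
    ((|u.coord.1 - v.coord.1| + |u.coord.2 - v.coord.2| : ℤ) : ℝ) ≤
      2 / lam * dist (u : Plane) (v : Plane) := by
  have apply_sub_le (i : Fin 2) : |(u : Plane) i - (v : Plane) i| ≤ dist (u : Plane) v := by
    rw [dist_eq_norm]
    simpa using PiLp.norm_apply_le ((u : Plane) - (v : Plane)) i
  have h₀ := apply_sub_le 0
  have h₁ := apply_sub_le 1
  rw [u.apply_zero, v.apply_zero, ← sub_mul, abs_mul, abs_of_pos hlam] at h₀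
  rw [u.apply_one, v.apply_one, ← sub_mul, abs_mul, abs_of_pos hlam] at h₁
  push_cast
  rw [div_mul_eq_mul_div, le_div_iff₀ hlam]
  linarith

/-- The cell that contains the node `u` when the lattice is divided into cells of `s × s` points,
shifted diagonally by `a`. -/
noncomputable def Node.cell (s a : ℕ) (u : C.Node) : ℤ × ℤ :=
  ((u.coord.1 + a) / (s : ℤ), (u.coord.2 + a) / (s : ℤ))

theorem Node.card_filter_cell_ne_le (s : ℕ) (u v : C.Node) :
    (((Finset.range s).filter fun a => u.cell s a ≠ v.cell s a).card : ℤ) ≤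
      |u.coord.1 - v.coord.1| + |u.coord.2 - v.coord.2| := by
  refine le_trans ?_ (add_le_add (card_filter_add_ediv_ne_le s _ _)
    (card_filter_add_ediv_ne_le s _ _))
  rw [← Nat.cast_add, Nat.cast_le]
  refine (Finset.card_le_card fun a => ?_).trans (Finset.card_union_le _ _)
  simp only [Finset.mem_filter, Finset.mem_union, cell, ne_eq, Prod.mk.injEq]
  tauto

end Circuit

namespace FixedLengthComputation

open Circuit

variable {lam : ℝ} {C : Circuit lam} {m m' : ℕ}

theorem card_inputsIn_cell_le (A : FixedLengthComputation C m m') {s : ℕ} (hs : 0 < s) (a : ℕ)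
    (q : ℤ × ℤ) : (A.inputsIn (Node.cell s a ⁻¹' {q})).card ≤ s ^ 2 := by
  have hs' : (0 : ℤ) < s := by exact_mod_cast hs
  let side (c : ℤ) : Finset ℤ := Finset.Ico (c * s - a) (c * s - a + s)
  have mem_side {x c : ℤ} (h : (x + a) / (s : ℤ) = c) : x ∈ side c := by
    rw [Int.ediv_eq_iff_of_pos hs'] at h
    rw [Finset.mem_Ico]
    constructor <;> linarith
  calc _ ≤ (side q.1 ×ˢ side q.2).card := by
        refine Finset.card_le_card_of_injOn (fun i => (A.inputNode i).coord) (fun i hi => ?_)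
          (Node.coord_injective.comp A.inputNode.injective).injOn
        have hq : (A.inputNode i).cell s a = q := mem_inputsIn.1 hi
        obtain ⟨h₁, h₂⟩ := Prod.ext_iff.1 hq
        exact Finset.mem_product.2 ⟨mem_side h₁, mem_side h₂⟩
    _ = s ^ 2 := by simp [side, sq]

theorem bitMeters_eq_sum (A : FixedLengthComputation C m m') :
    A.bitMeters = ∑ t, (A.bits t : ℝ) * dist (A.src t : Plane) (A.dst t : Plane) := by
  classical
  unfold bitMeters linkBitMeters linkBits
  simp only [Nat.cast_sum, Finset.sum_mul]
  rw [Finset.sum_congr rfl fun u _ => Finset.sum_comm, Finset.sum_comm]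
  refine Finset.sum_congr rfl fun t _ => ?_
  rw [Fintype.sum_eq_single (A.src t), Fintype.sum_eq_single (A.dst t)]
  · simp
  · intro v hv
    simp [hv.symm]
  · intro u hu
    simp [hu.symm]

theorem bitMeters_nonneg (A : FixedLengthComputation C m m') : 0 ≤ A.bitMeters := by
  rw [bitMeters_eq_sum]
  positivity

theorem frictionEnergy_nonneg (A : FixedLengthComputation C m m') {mu : ℝ} (hmu : 0 ≤ mu) :
    0 ≤ A.frictionEnergy mu :=
  mul_nonneg hmu A.bitMeters_nonneg

theorem sum_crossingBits_cell_le (hlam : 0 < lam) (A : FixedLengthComputation C m m') (s : ℕ) :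
    ∑ a ∈ Finset.range s, (A.crossingBits (Node.cell s a) : ℝ) ≤ 2 / lam * A.bitMeters := by
  classical
  have card_shifts_le (u v : C.Node) :
      (((Finset.range s).filter fun a => u.cell s a ≠ v.cell s a).card : ℝ) ≤
        2 / lam * dist (u : Plane) (v : Plane) :=
    le_trans (by exact_mod_cast Node.card_filter_cell_ne_le s u v)
      (Node.abs_coord_sub_add_le hlam u v)
  calc _ = ∑ t, ∑ a ∈ Finset.range s with (A.src t).cell s a ≠ (A.dst t).cell s a,
          (A.bits t : ℝ) := by
        simp only [crossingBits, Finset.sum_filter, Nat.cast_sum, Nat.cast_ite, Nat.cast_zero]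
        exact Finset.sum_comm
    _ ≤ ∑ t, 2 / lam * dist (A.src t : Plane) (A.dst t : Plane) * A.bits t := by
        refine Finset.sum_le_sum fun t _ => ?_
        rw [Finset.sum_const, nsmul_eq_mul]
        exact mul_le_mul_of_nonneg_right (card_shifts_le _ _) (Nat.cast_nonneg _)
    _ = 2 / lam * A.bitMeters := by
        rw [bitMeters_eq_sum, Finset.mul_sum]
        exact Finset.sum_congr rfl fun t _ => by ring

theorem exists_region_inflow_lt (hlam : 0 < lam) (A : FixedLengthComputation C m m') {s : ℕ}
    (h : 2 / lam * A.bitMeters < s * m') :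
    ∃ T : Set C.Node, (A.inputsIn T).card ≤ s ^ 2 ∧ A.inflow T < (A.outputsIn T).card := by
  obtain ⟨a, ha, hcross⟩ : ∃ a ∈ Finset.range s, (A.crossingBits (Node.cell s a) : ℝ) < m' := by
    refine Finset.exists_lt_of_sum_lt ((A.sum_crossingBits_cell_le hlam s).trans_lt ?_)
    simpa using h
  obtain ⟨q, hq⟩ := A.exists_inflow_fiber_lt (Nat.cast_lt.1 hcross)
  have hs : 0 < s := (Nat.zero_le a).trans_lt (Finset.mem_range.1 ha)
  exact ⟨_, A.card_inputsIn_cell_le hs a q, hq⟩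

theorem pow_sq_div_two_le_bscErrorProb {n k : ℕ} (hlam : 0 < lam)
    (A : FixedLengthComputation C n k) {s : ℕ} (h : 2 / lam * A.bitMeters < s * k) {p : ℝ}
    (hp₀ : 0 ≤ p) (hp : p ≤ 1 / 2) (enc : (Fin k → Bool) → Fin n → Bool) :
    p ^ s ^ 2 / 2 ≤ bscErrorProb p enc A.output := by
  obtain ⟨T, hinputs, hT⟩ := A.exists_region_inflow_lt hlam h
  refine le_trans ?_ (A.pow_div_two_le_bscErrorProb_of_inflow_lt hT hp₀ hp enc)
  exact div_le_div_of_nonneg_right (pow_le_pow_of_le_one hp₀ (by linarith) hinputs) zero_le_two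

end FixedLengthComputation

/-! ### The Gaussian tail -/

section GaussianTail

open MeasureTheory ProbabilityTheory

theorem gaussianQ_eq_setIntegral (x : ℝ) :
    gaussianQ x = ∫ t in Set.Ioi x, gaussianPDFReal 0 1 t := by
  simp [gaussianQ, gaussianPDFReal]

theorem gaussianQ_zero : gaussianQ 0 = 1 / 2 := by
  have exponent_eq (t : ℝ) : -t ^ 2 / 2 = -(1 / 2) * t ^ 2 := by ring
  have hsqrt : Real.sqrt (2 * Real.pi) ≠ 0 := by positivity
  simp only [gaussianQ, exponent_eq, integral_const_mul, integral_gaussian_Ioi]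
  rw [show Real.pi / (1 / 2) = 2 * Real.pi by ring]
  field_simp

theorem gaussianQ_le_half {x : ℝ} (hx : 0 ≤ x) : gaussianQ x ≤ 1 / 2 := by
  rw [← gaussianQ_zero, gaussianQ_eq_setIntegral, gaussianQ_eq_setIntegral]
  exact setIntegral_mono_set (integrable_gaussianPDFReal 0 1).integrableOn
    (ae_of_all _ (gaussianPDFReal_nonneg 0 1)) (Set.Ioi_subset_Ioi hx).eventuallyLE

theorem exp_neg_one_le_inv_sqrt_two_pi : Real.exp (-1) ≤ (Real.sqrt (2 * Real.pi))⁻¹ := by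
  rw [Real.exp_neg]
  refine inv_anti₀ (by positivity) (Real.sqrt_le_iff.2 ⟨(Real.exp_pos _).le, ?_⟩)
  nlinarith [Real.pi_lt_d2, Real.exp_one_gt_d9]

theorem exp_le_gaussianQ {x : ℝ} (hx : 0 ≤ x) : Real.exp (-(x ^ 2 + 2)) ≤ gaussianQ x := by
  have le_density (t : ℝ) (ht : t ∈ Set.Ioc x (x + 1)) :
      Real.exp (-(x ^ 2 + 2)) ≤ gaussianPDFReal 0 1 t := by
    have hexponent : -(x ^ 2 + 1) ≤ -t ^ 2 / 2 := by
      nlinarith [ht.1, ht.2, sq_nonneg (x - 1)]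
    calc Real.exp (-(x ^ 2 + 2)) = Real.exp (-1) * Real.exp (-(x ^ 2 + 1)) := by
          rw [← Real.exp_add]
          ring_nf
      _ ≤ (Real.sqrt (2 * Real.pi))⁻¹ * Real.exp (-t ^ 2 / 2) :=
          mul_le_mul exp_neg_one_le_inv_sqrt_two_pi (Real.exp_le_exp.2 hexponent)
            (Real.exp_pos _).le (by positivity)
      _ = gaussianPDFReal 0 1 t := by simp [gaussianPDFReal]
  have hint := integrable_gaussianPDFReal 0 1
  calc Real.exp (-(x ^ 2 + 2))
      = Real.exp (-(x ^ 2 + 2)) * volume.real (Set.Ioc x (x + 1)) := by simp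
    _ ≤ ∫ t in Set.Ioc x (x + 1), gaussianPDFReal 0 1 t :=
        setIntegral_ge_of_const_le_real measurableSet_Ioc (by simp) le_density hint.integrableOn
    _ ≤ gaussianQ x := by
        rw [gaussianQ_eq_setIntegral]
        exact setIntegral_mono_set hint.integrableOn (ae_of_all _ (gaussianPDFReal_nonneg 0 1))
          Set.Ioc_subset_Ioi_self.eventuallyLE

end GaussianTail

theorem crossover_le_half (zeta sigmaSq P : ℝ) : crossover zeta sigmaSq P ≤ 1 / 2 :=
  gaussianQ_le_half (Real.sqrt_nonneg _)

theorem exp_le_crossover {zeta sigmaSq P : ℝ} (h : 0 ≤ zeta * P / sigmaSq) :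
    Real.exp (-(zeta * P / sigmaSq + 2)) ≤ crossover zeta sigmaSq P := by
  simpa only [crossover, Real.sq_sqrt h] using
    exp_le_gaussianQ (Real.sqrt_nonneg (zeta * P / sigmaSq))

/-! ### Error probability and energy -/

/-- A communication system of rate at most `R` in which only the decoder is implemented on a
circuit: the codewords come from an arbitrary map `encode`, whose computation is free. -/
structure FreeEncoderSystem (lam R : ℝ) where
  k : ℕ
  n : ℕ
  k_pos : 0 < k
  rate_le : (k : ℝ) ≤ R * n
  power : ℝ
  power_nonneg : 0 ≤ power
  encode : (Fin k → Bool) → Fin n → Bool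
  decCircuit : Circuit lam
  decoder : FixedLengthComputation decCircuit n k

namespace FreeEncoderSystem

variable {lam R mu zeta sigmaSq W : ℝ}

/-- The average block-error probability of the system over the hard-decision BPSK channel. -/
noncomputable def blockErrorProb (S : FreeEncoderSystem lam R) (zeta sigmaSq : ℝ) : ℝ :=
  bscErrorProb (crossover zeta sigmaSq S.power) S.encode S.decoder.output

/-- The energy of transmission and decoding, per information bit. -/
noncomputable def energyPerBit (S : FreeEncoderSystem lam R) (mu W : ℝ) : ℝ :=
  (S.n * S.power / W + S.decoder.frictionEnergy mu) / S.k

theorem n_pos (S : FreeEncoderSystem lam R) : 0 < S.n := by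
  refine Nat.pos_of_ne_zero fun hn => ?_
  have h := S.rate_le
  rw [hn, Nat.cast_zero, mul_zero] at h
  exact h.not_gt (Nat.cast_pos.2 S.k_pos)

theorem energyPerBit_mul_k (S : FreeEncoderSystem lam R) :
    S.energyPerBit mu W * S.k = S.n * S.power / W + S.decoder.frictionEnergy mu :=
  div_mul_cancel₀ _ (Nat.cast_ne_zero.2 S.k_pos.ne')

theorem energyPerBit_nonneg (S : FreeEncoderSystem lam R) (hmu : 0 ≤ mu) (hW : 0 ≤ W) :
    0 ≤ S.energyPerBit mu W := by
  have := S.power_nonneg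
  have := S.decoder.frictionEnergy_nonneg hmu
  unfold energyPerBit
  positivity

theorem power_le (S : FreeEncoderSystem lam R) (hmu : 0 ≤ mu) (hW : 0 < W) :
    S.power ≤ W * R * S.energyPerBit mu W := by
  have hn : (0 : ℝ) < S.n := Nat.cast_pos.2 S.n_pos
  have htransmit : S.n * S.power / W ≤ R * S.n * S.energyPerBit mu W :=
    calc S.n * S.power / W ≤ S.energyPerBit mu W * S.k := by
          linarith [S.energyPerBit_mul_k (mu := mu) (W := W), S.decoder.frictionEnergy_nonneg hmu]
      _ ≤ S.energyPerBit mu W * (R * S.n) :=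
          mul_le_mul_of_nonneg_left S.rate_le (S.energyPerBit_nonneg hmu hW.le)
      _ = R * S.n * S.energyPerBit mu W := mul_comm _ _
  rw [div_le_iff₀ hW] at htransmit
  exact le_of_mul_le_mul_left (by linarith) hn

theorem bitMeters_decoder_le (S : FreeEncoderSystem lam R) (hmu : 0 < mu) (hW : 0 ≤ W) :
    S.decoder.bitMeters ≤ S.energyPerBit mu W / mu * S.k := by
  have htransmit : 0 ≤ S.n * S.power / W :=
    div_nonneg (mul_nonneg (Nat.cast_nonneg _) S.power_nonneg) hW
  rw [div_mul_eq_mul_div, le_div_iff₀ hmu, S.energyPerBit_mul_k, mul_comm]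
  exact le_add_of_nonneg_left htransmit

theorem exp_le_blockErrorProb (S : FreeEncoderSystem lam R) (hlam : 0 < lam) (hzeta : 0 ≤ zeta)
    (hsigmaSq : 0 ≤ sigmaSq) {s : ℕ} (h : 2 / lam * S.decoder.bitMeters < s * S.k) :
    Real.exp (-((zeta * S.power / sigmaSq + 2) * s ^ 2 + 1)) ≤ S.blockErrorProb zeta sigmaSq := by
  set snr := zeta * S.power / sigmaSq
  have hp := exp_le_crossover (div_nonneg (mul_nonneg hzeta S.power_nonneg) hsigmaSq)
  have hp₀ := (Real.exp_pos _).le.trans hp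
  calc Real.exp (-((snr + 2) * s ^ 2 + 1)) = Real.exp (-(snr + 2)) ^ s ^ 2 * Real.exp (-1) := by
        rw [← Real.exp_nat_mul, ← Real.exp_add]
        push_cast
        ring_nf
    _ ≤ crossover zeta sigmaSq S.power ^ s ^ 2 * (1 / 2) := by
        gcongr
        exact Real.exp_neg_one_lt_half.le
    _ = crossover zeta sigmaSq S.power ^ s ^ 2 / 2 := mul_one_div _ _
    _ ≤ S.blockErrorProb zeta sigmaSq :=
        S.decoder.pow_sq_div_two_le_bscErrorProb hlam h hp₀ (crossover_le_half _ _ _) S.encode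

theorem exists_exp_le_blockErrorProb (S : FreeEncoderSystem lam R) (hlam : 0 < lam) (hmu : 0 < mu)
    (hzeta : 0 ≤ zeta) (hsigmaSq : 0 ≤ sigmaSq) (hW : 0 ≤ W) :
    ∃ s : ℕ, (s : ℝ) ≤ 2 / (lam * mu) * S.energyPerBit mu W + 1 ∧
      Real.exp (-((zeta * S.power / sigmaSq + 2) * s ^ 2 + 1)) ≤ S.blockErrorProb zeta sigmaSq := by
  set E := S.energyPerBit mu W
  have hE : 0 ≤ E := S.energyPerBit_nonneg hmu.le hW
  refine ⟨⌊2 / (lam * mu) * E⌋₊ + 1, ?_, S.exp_le_blockErrorProb hlam hzeta hsigmaSq ?_⟩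
  · push_cast
    gcongr
    exact Nat.floor_le (by positivity)
  · have hk : (0 : ℝ) < S.k := Nat.cast_pos.2 S.k_pos
    calc 2 / lam * S.decoder.bitMeters ≤ 2 / lam * (E / mu * S.k) := by
          gcongr
          exact S.bitMeters_decoder_le hmu hW
      _ = 2 / (lam * mu) * E * S.k := by
          field_simp
      _ < _ := by
          push_cast
          gcongr
          exact Nat.lt_floor_add_one _

theorem blockErrorProb_pos (S : FreeEncoderSystem lam R) (hlam : 0 < lam) (hzeta : 0 ≤ zeta)
    (hsigmaSq : 0 ≤ sigmaSq) : 0 < S.blockErrorProb zeta sigmaSq := by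
  obtain ⟨s, -, hs⟩ :=
    S.exists_exp_le_blockErrorProb hlam one_pos hzeta hsigmaSq zero_le_one
  exact (Real.exp_pos _).trans_le hs

theorem log_one_div_blockErrorProb_le (S : FreeEncoderSystem lam R) (hlam : 0 < lam)
    (hmu : 0 < mu) (hzeta : 0 ≤ zeta) (hsigmaSq : 0 ≤ sigmaSq) (hW : 0 < W) (hR : 0 ≤ R) :
    Real.log (1 / S.blockErrorProb zeta sigmaSq) ≤
      ((zeta * (W * R) / sigmaSq + 2) * (2 / (lam * mu) + 1) ^ 2 + 1) *
        (1 + S.energyPerBit mu W) ^ 3 := by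
  set E := S.energyPerBit mu W
  set α := zeta * (W * R) / sigmaSq
  set β := 2 / (lam * mu)
  have hE : 0 ≤ E := S.energyPerBit_nonneg hmu.le hW.le
  have hα : 0 ≤ α := by positivity
  have hβ : 0 ≤ β := by positivity
  obtain ⟨s, hs, hexp⟩ := S.exists_exp_le_blockErrorProb hlam hmu hzeta hsigmaSq hW.le
  have hsnr : zeta * S.power / sigmaSq + 2 ≤ (α + 2) * (1 + E) :=
    calc zeta * S.power / sigmaSq + 2 ≤ zeta * (W * R * E) / sigmaSq + 2 := by
          gcongr
          exact S.power_le hmu.le hW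
      _ = α * E + 2 := by ring
      _ ≤ (α + 2) * (1 + E) := by nlinarith
  have hside : (s : ℝ) ≤ (β + 1) * (1 + E) := by nlinarith
  calc Real.log (1 / S.blockErrorProb zeta sigmaSq)
      ≤ (zeta * S.power / sigmaSq + 2) * s ^ 2 + 1 := by
        have := (Real.le_log_iff_exp_le (S.blockErrorProb_pos hlam hzeta hsigmaSq)).2 hexp
        rw [one_div, Real.log_inv]
        linarith
    _ ≤ (α + 2) * (1 + E) * ((β + 1) * (1 + E)) ^ 2 + (1 + E) ^ 3 := by
        gcongr
        exact one_le_pow₀ (by linarith)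
    _ = ((α + 2) * (β + 1) ^ 2 + 1) * (1 + E) ^ 3 := by ring

end FreeEncoderSystem

/-! ### From the cubic bound to the limits -/

theorem rpow_one_third_le_of_le_mul_cube {K L E : ℝ} (hK : 0 < K) (hL : K * 2 ^ 3 ≤ L)
    (h : L ≤ K * (1 + E) ^ 3) : 1 / (2 * K ^ (1 / 3 : ℝ)) * L ^ (1 / 3 : ℝ) ≤ E := by
  have hE : 2 ≤ 1 + E :=
    (Odd.pow_le_pow (by decide)).1 (le_of_mul_le_mul_left (hL.trans h) hK)
  have hcbrt : L ^ (1 / 3 : ℝ) ≤ K ^ (1 / 3 : ℝ) * (1 + E) :=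
    calc L ^ (1 / 3 : ℝ) ≤ (K * (1 + E) ^ 3) ^ (1 / 3 : ℝ) :=
          Real.rpow_le_rpow (le_trans (by positivity) hL) h (by norm_num)
      _ = K ^ (1 / 3 : ℝ) * (1 + E) := by
          rw [Real.mul_rpow hK.le (by positivity)]
          congr 1
          simpa using Real.pow_rpow_inv_natCast (x := 1 + E) (by linarith) three_ne_zero
  have hκ : 0 < K ^ (1 / 3 : ℝ) := by positivity
  rw [one_div_mul_eq_div, div_le_iff₀ (by positivity)]
  nlinarith

theorem le_log_one_div_of_le_exp_neg {p L : ℝ} (hp : 0 < p) (h : p ≤ Real.exp (-L)) :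
    L ≤ Real.log (1 / p) := by
  rw [one_div, Real.log_inv]
  linarith [(Real.log_le_iff_le_exp hp).2 h]

theorem limits_of_log_one_div_le_mul_cube {ι : Type*} {p E : ι → ℝ} {K : ℝ} (hK : 0 < K)
    (hp : ∀ i, 0 < p i) (h : ∀ i, Real.log (1 / p i) ≤ K * (1 + E i) ^ 3) :
    (∃ c : ℝ, 0 < c ∧ ∃ ε : ℝ, 0 < ε ∧ ∀ i, p i ≤ ε →
      c * Real.log (1 / p i) ^ (1 / 3 : ℝ) ≤ E i) ∧
    (∀ M : ℝ, ∃ ε : ℝ, 0 < ε ∧ ∀ i, p i ≤ ε → M ≤ E i) := by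
  refine ⟨⟨1 / (2 * K ^ (1 / 3 : ℝ)), by positivity, Real.exp (-(K * 2 ^ 3)), Real.exp_pos _,
    fun i hi => rpow_one_third_le_of_le_mul_cube hK (le_log_one_div_of_le_exp_neg (hp i) hi) (h i)⟩,
    fun M => ⟨Real.exp (-(K * (1 + M) ^ 3)), Real.exp_pos _, fun i hi => ?_⟩⟩
  have hcube : K * (1 + M) ^ 3 ≤ K * (1 + E i) ^ 3 :=
    (le_log_one_div_of_le_exp_neg (hp i) hi).trans (h i)
  have hle : 1 + M ≤ 1 + E i := (Odd.pow_le_pow (by decide)).1 (le_of_mul_le_mul_left hcube hK)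
  linarith

theorem mainTheorem3_general (lam mu zeta sigmaSq W R : ℝ) (hlam : 0 < lam) (hmu : 0 < mu)
    (hzeta : 0 < zeta) (hsigmaSq : 0 < sigmaSq) (hW : 0 < W) (hR : 0 < R) :
    (∃ c : ℝ, 0 < c ∧ ∃ ε : ℝ, 0 < ε ∧ ∀ S : FreeEncoderSystem lam R,
      S.blockErrorProb zeta sigmaSq ≤ ε →
        c * (Real.log (1 / S.blockErrorProb zeta sigmaSq)) ^ (1 / 3 : ℝ) ≤ S.energyPerBit mu W) ∧
    (∀ M : ℝ, ∃ ε : ℝ, 0 < ε ∧ ∀ S : FreeEncoderSystem lam R,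
      S.blockErrorProb zeta sigmaSq ≤ ε → M ≤ S.energyPerBit mu W) :=
  limits_of_log_one_div_le_mul_cube
    (K := (zeta * (W * R) / sigmaSq + 2) * (2 / (lam * mu) + 1) ^ 2 + 1) (by positivity)
    (fun S => S.blockErrorProb_pos hlam hzeta.le hsigmaSq.le)
    (fun S => S.log_one_div_blockErrorProb_le hlam hmu hzeta.le hsigmaSq.le hW hR.le)

namespace CommSystem

variable {lam R : ℝ}

/-- The communication system `S` with its encoder replaced by the map which it computes. -/
def freeEncoder (S : CommSystem lam R) : FreeEncoderSystem lam R where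
  k := S.k
  n := S.n
  k_pos := S.k_pos
  rate_le := ((div_eq_iff (Nat.cast_ne_zero.2 S.n_pos.ne')).1 S.rate_eq).le
  power := S.power
  power_nonneg := S.power_nonneg
  encode := S.encoder.output
  decCircuit := S.decCircuit
  decoder := S.decoder

theorem energyPerBit_freeEncoder_le (S : CommSystem lam R) {mu : ℝ} (hmu : 0 ≤ mu) (W : ℝ) :
    S.freeEncoder.energyPerBit mu W ≤ S.energyPerBit mu W := by
  refine div_le_div_of_nonneg_right ?_ (Nat.cast_nonneg _)
  exact add_le_add_left (le_add_of_nonneg_right (S.encoder.frictionEnergy_nonneg hmu)) _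

end CommSystem

theorem mainTheorem3 (lam mu zeta sigmaSq W R : ℝ) (hlam : 0 < lam) (hmu : 0 < mu)
    (hzeta : 0 < zeta) (hsigmaSq : 0 < sigmaSq) (hW : 0 < W) (hR : 0 < R) :
    (∃ c : ℝ, 0 < c ∧ ∃ ε : ℝ, 0 < ε ∧ ∀ S : CommSystem lam R,
      S.blockErrorProb zeta sigmaSq ≤ ε →
        c * (Real.log (1 / S.blockErrorProb zeta sigmaSq)) ^ (1 / 3 : ℝ) ≤ S.energyPerBit mu W) ∧
    (∀ M : ℝ, ∃ ε : ℝ, 0 < ε ∧ ∀ S : CommSystem lam R,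
      S.blockErrorProb zeta sigmaSq ≤ ε → M ≤ S.energyPerBit mu W) := by
  obtain ⟨⟨c, hc, ε, hε, hlimit⟩, hdiverge⟩ :=
    mainTheorem3_general lam mu zeta sigmaSq W R hlam hmu hzeta hsigmaSq hW hR
  exact ⟨⟨c, hc, ε, hε, fun S hS =>
      (hlimit S.freeEncoder hS).trans (S.energyPerBit_freeEncoder_le hmu.le W)⟩,
    fun M => (hdiverge M).imp fun _ hM => ⟨hM.1, fun S hS =>
      (hM.2 S.freeEncoder hS).trans (S.energyPerBit_freeEncoder_le hmu.le W)⟩⟩
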